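/- Model. Time is discrete. A set of $n$ sporadic tasks $\tau_1,\dots,\tau_n$, indexed by decreasing priority, is run on one processor by preemptive fixed-priority scheduling. Task $\tau_i$ has a relative deadline $D_i$ and a minimum inter-arrival time $T_i$, integers with $1\le D_i\le T_i$, and an execution-time distribution $\mathcal C_i$, a discrete probability distribution on the nonnegative integers. The execution time $\mathcal C_{i,x}$ of the $x$-th job $\tau_{i,x}$ of $\tau_i$ has distribution $\mathcal C_i$, and all execution times are independent. A release time pattern $\xi\in\Xi$ assigns to each task finitely or infinitely many release times $r_{i,1},r_{i,2},\dots\in\mathbb N$ with $r_{i,x+1}\ge r_{i,x}+T_i$. A job that is not finished by its absolute deadline $r_{i,x}+D_i$ is aborted at that time. Let $\mathcal R^{\xi}_{i,x}$ be the response time of $\tau_{i,x}$ under $\xi$, with value $\infty$ if the job is aborted, and let $$\mathrm{WCDFP}_k=\sup_{\xi\in\Xi}\ \sup_{x\ge 1}\ \mathbb P(\mathcal R^{\xi}_{k,x}>D_k),$$ where $x$ ranges over the jobs of $\tau_k$ released in $\xi$. Fix a task $\tau_k$. Put $$\rho=\inf_{0<t\le D_k}\mathbb P\Big(\mathcal C_{k,1}+\sum_{j<k}\sum_{x=1}^{\lceil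 t/T_j\rceil}\mathcal C_{j,x}>t\Big),\qquad n_i=\Big\lceil \tfrac{1}{T_i}\sum_{j=i}^{k-1}D_j\Big\rceil\ (1\le i<k),\qquad n_k=1.$$ Let $\xi^*$ be the pattern in which $\tau_k$ releases a single job at time $0$ and each $\tau_j$ with $j<k$ releases jobs exactly at the times $0,T_j,2T_j,\dots$. Let $\mathrm{BW}^{\xi^*}\in\mathbb N\cup\{\infty\}$ be the length of the busy period of $\tau_1,\dots,\tau_k$ that starts at time $0$ under $\xi^*$, where jobs are executed completely (no job is aborted): it is the least $\Delta>0$ at which the total execution time of the jobs of these tasks released in $[0,\Delta)$ is at most $\Delta$ (it is $0$ if all jobs released at time $0$ have execution time $0$, and $\infty$ if there is no such $\Delta$). Theorem. For every task $\tau_k$, $$\mathrm{WCDFP}_k\ \le\ \sum_{i=1}^{k}\sum_{j=1}^{n_i}\min\Big\{\mathbb P\big(\mathrm{BW}^{\xi^*}\ge (j-1)T_i+D_k\big),\ \rho\Big\}.$$ -/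

import Mathlib

open MeasureTheory

/-- A set of `n` sporadic real-time tasks with probabilistic execution times and constrained
deadlines, in discrete time. Tasks are indexed by decreasing priority: `i < j` means that task `i`
has higher priority than task `j`. -/
structure TaskSet (n : ℕ) where
  /-- the minimum inter-arrival time `T i` -/
  period : Fin n → ℕ
  /-- the relative deadline `D i` -/
  deadline : Fin n → ℕ
  /-- the distribution of the execution time of each job of task `i` -/
  pwcet : Fin n → PMF ℕ
  deadline_pos : ∀ i, 0 < deadline i
  deadline_le_period : ∀ i, deadline i ≤ period i

namespace TaskSet

/-- A release time pattern: `release i x` is the release time of job `x` of task `i` (jobs are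
numbered from `0`). The value `⊤` means that the job is never released, so that a task may release
finitely or infinitely many jobs. -/
structure ReleasePattern {n : ℕ} (𝒯 : TaskSet n) where
  release : Fin n → ℕ → ℕ∞
  separated : ∀ i x, release i x + (𝒯.period i : ℕ∞) ≤ release i (x + 1)

/-- An execution time pattern: `ω (i, x)` is the execution time of job `x` of task `i`. -/
abbrev ExecPattern (n : ℕ) : Type := Fin n × ℕ → ℕ

/-- The probability on execution time patterns that makes all execution times independent, with
`ω (i, x)` distributed as `pwcet i`. -/
noncomputable def execMeasure {n : ℕ} (𝒯 : TaskSet n) : Measure (ExecPattern n) :=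
  Measure.infinitePi fun p : Fin n × ℕ => (𝒯.pwcet p.1).toMeasure

/-! ### Preemptive fixed-priority schedule, jobs being aborted at their deadlines -/

/-- Job `x` of task `i` is ready at time `t`, when `e j y` is the amount of time for which each
job `(j, y)` has executed before `t`: it is released, its absolute deadline has not been reached
(otherwise it has finished or is aborted), and it is not finished. -/
def Ready {n : ℕ} (𝒯 : TaskSet n) (ξ : 𝒯.ReleasePattern) (ω : ExecPattern n)
    (e : Fin n → ℕ → ℕ) (t : ℕ) (i : Fin n) (x : ℕ) : Prop :=
  ξ.release i x ≤ (t : ℕ∞) ∧ (t : ℕ∞) < ξ.release i x + (𝒯.deadline i : ℕ∞) ∧ e i x < ω (i, x)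

/-- Job `x` of task `i` executes in the time slot `[t, t + 1)`: it is the ready job of highest
priority. (Because deadlines are constrained, at most one job of each task is ready at a time, so
the order among the jobs of one task plays no role.) -/
def Runs {n : ℕ} (𝒯 : TaskSet n) (ξ : 𝒯.ReleasePattern) (ω : ExecPattern n)
    (e : Fin n → ℕ → ℕ) (t : ℕ) (i : Fin n) (x : ℕ) : Prop :=
  𝒯.Ready ξ ω e t i x ∧ (∀ j < i, ∀ y, ¬ 𝒯.Ready ξ ω e t j y) ∧
    ∀ y < x, ¬ 𝒯.Ready ξ ω e t i y

open Classical in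
/-- `service ξ ω t i x` is the amount of time for which job `x` of task `i` executes in `[0, t)`. -/
noncomputable def service {n : ℕ} (𝒯 : TaskSet n) (ξ : 𝒯.ReleasePattern) (ω : ExecPattern n) :
    ℕ → Fin n → ℕ → ℕ
  | 0 => fun _ _ => 0
  | t + 1 => fun i x =>
      service 𝒯 ξ ω t i x + if 𝒯.Runs ξ ω (service 𝒯 ξ ω t) t i x then 1 else 0

/-- The response time of job `x` of task `i`: the least `d` such that the job is finished `d` time
units after its release; it is `⊤` if the job never finishes, in particular if it is aborted. -/
noncomputable def responseTime {n : ℕ} (𝒯 : TaskSet n) (ξ : 𝒯.ReleasePattern) (ω : ExecPattern n)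
    (i : Fin n) (x : ℕ) : ℕ∞ :=
  ⨅ (d : ℕ) (s : ℕ) (_ : (s : ℕ∞) = ξ.release i x + (d : ℕ∞) ∧
    ω (i, x) ≤ 𝒯.service ξ ω s i x), (d : ℕ∞)

/-- The deadline failure probability of job `x` of task `i` under the release pattern `ξ`. -/
noncomputable def dfp {n : ℕ} (𝒯 : TaskSet n) (ξ : 𝒯.ReleasePattern) (i : Fin n) (x : ℕ) :
    ENNReal :=
  𝒯.execMeasure {ω | (𝒯.deadline i : ℕ∞) < 𝒯.responseTime ξ ω i x}

/-- The worst-case deadline failure probability of task `i`, over all release patterns and all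
jobs that are released. -/
noncomputable def wcdfp {n : ℕ} (𝒯 : TaskSet n) (i : Fin n) : ENNReal :=
  ⨆ (ξ : 𝒯.ReleasePattern) (x : ℕ) (_ : ξ.release i x ≠ ⊤), 𝒯.dfp ξ i x

/-! ### The two bounds -/

open Classical in
/-- The synchronous pattern `ξ*` for task `k`: all tasks of higher priority than `k` release jobs
periodically from time `0` on, and the analyzed job of task `k` is released at time `0`. -/
noncomputable def syncPattern {n : ℕ} (𝒯 : TaskSet n) (k : Fin n) : 𝒯.ReleasePattern where
  release j y := if j < k then ((y * 𝒯.period j : ℕ) : ℕ∞) else if j = k ∧ y = 0 then 0 else ⊤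
  separated := by
    intro i x
    by_cases h : i < k
    · simp only [h, if_true]
      rw [← Nat.cast_add, add_mul, one_mul]
    · simp [h]

open Classical in
/-- The total execution demand of the jobs of tasks of priority at least that of `k` that are
released in `[0, Δ)`. Since periods are positive, such a job has an index less than `Δ`. -/
noncomputable def workload {n : ℕ} (𝒯 : TaskSet n) (ξ : 𝒯.ReleasePattern) (k : Fin n)
    (ω : ExecPattern n) (Δ : ℕ) : ℕ :=
  ∑ j ∈ Finset.Iic k, ∑ y ∈ Finset.range Δ with ξ.release j y < (Δ : ℕ∞), ω (j, y)

/-- The length of the busy period of tasks of priority at least that of `k` that starts at time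
`0`: the first time `Δ` at which all the work released before has been processed, without
aborting jobs. The `max` counts the jobs released at time `0` also for `Δ = 0`, so that the length
is `0` only if those jobs need no execution. The value is `⊤` if the busy period never ends. -/
noncomputable def busyPeriod {n : ℕ} (𝒯 : TaskSet n) (ξ : 𝒯.ReleasePattern) (k : Fin n)
    (ω : ExecPattern n) : ℕ∞ :=
  ⨅ (Δ : ℕ) (_ : 𝒯.workload ξ k ω (max Δ 1) ≤ Δ), (Δ : ℕ∞)

/-- The quantity `ρ = inf_{0 < t ≤ D_k} ℙ (C_{k,1} + ∑_{j < k} ∑_{x = 1}^{⌈t / T_j⌉} C_{j,x} > t)`. -/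
noncomputable def rho {n : ℕ} (𝒯 : TaskSet n) (k : Fin n) : ENNReal :=
  ⨅ t ∈ Set.Ioc 0 (𝒯.deadline k), 𝒯.execMeasure
    {ω | t < ω (k, 0) + ∑ j ∈ Finset.Iio k, ∑ x ∈ Finset.range (t ⌈/⌉ 𝒯.period j), ω (j, x)}

/-- The number `n_i = ⌈(∑_{i ≤ j < k} D_j) / T_i⌉` for `i < k`, and `n_k = 1`. -/
def numStarts {n : ℕ} (𝒯 : TaskSet n) (k i : Fin n) : ℕ :=
  if i = k then 1 else (∑ j ∈ Finset.Ico i k, 𝒯.deadline j) ⌈/⌉ 𝒯.period i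

end TaskSet

namespace TaskSet

variable {n : ℕ} (𝒯 : TaskSet n)

/-! Suppose the job of `k` released at `r` misses its deadline. Start with `s = r` and run through
the higher-priority tasks from lowest to highest; whenever the current task has a pending job at
`s`, move `s` back to the release of that job. In the end (`exists_busyFrom`) only jobs released
since `s` execute in `[s, r + D_k)`, and one of them is always pending, so the work released since
`s` exceeds the elapsed time throughout the interval (`BusyFrom.mem_overload`).

A move by task `j` costs less than `D_j`. If `i` is the last task that moved `s`, then `s` is one of
the last `n_i` releases of `i` before `r` (`IsStart.exists_startTime`). For fixed `ξ` these
candidates do not depend on the execution times, so a union bound applies. The `j`-th last candidate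
lies at least `(j - 1) T_i` before `r`, and renumbering the jobs from `s` on dominates its overload
event by that of the synchronous pattern (`execMeasure_overload_le`). The latter event lies in both
the busy-period event and every event in the infimum `ρ`. -/

theorem period_pos (i : Fin n) : 0 < 𝒯.period i :=
  (𝒯.deadline_pos i).trans_le (𝒯.deadline_le_period i)

/-! ### Release times -/

namespace ReleasePattern

variable {𝒯} (ξ : 𝒯.ReleasePattern)

theorem release_add_mul_le (i : Fin n) (y m : ℕ) :
    ξ.release i y + ((m * 𝒯.period i : ℕ) : ℕ∞) ≤ ξ.release i (y + m) := by
  induction m with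
  | zero => simp
  | succ m ih =>
    calc ξ.release i y + (((m + 1) * 𝒯.period i : ℕ) : ℕ∞)
        = ξ.release i y + ((m * 𝒯.period i : ℕ) : ℕ∞) + (𝒯.period i : ℕ∞) := by
          rw [add_mul, one_mul, Nat.cast_add, add_assoc]
      _ ≤ ξ.release i (y + m) + (𝒯.period i : ℕ∞) := by gcongr
      _ ≤ ξ.release i (y + (m + 1)) := ξ.separated i (y + m)

theorem le_release (i : Fin n) (y : ℕ) : (y : ℕ∞) ≤ ξ.release i y := by
  have h := ξ.release_add_mul_le i 0 y
  rw [zero_add] at h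
  refine le_trans ?_ (le_trans le_add_self h)
  exact_mod_cast Nat.le_mul_of_pos_right y (𝒯.period_pos i)

theorem release_mono (i : Fin n) : Monotone (ξ.release i) :=
  monotone_nat_of_le_succ fun y => le_trans le_self_add (ξ.separated i y)

/-- Constrained deadlines enter here: the scheduling windows of the jobs of one task are disjoint.
-/
theorem release_add_deadline_le (i : Fin n) {y z : ℕ} (h : y < z) :
    ξ.release i y + (𝒯.deadline i : ℕ∞) ≤ ξ.release i z := by
  refine le_trans ?_ ((ξ.separated i y).trans (ξ.release_mono i h))
  gcongr
  exact 𝒯.deadline_le_period i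

theorem exists_le_release (i : Fin n) (s : ℕ) : ∃ y, (s : ℕ∞) ≤ ξ.release i y :=
  ⟨s, ξ.le_release i s⟩

open Classical in
/-- The index of the first job of task `i` that is not released before time `s`. -/
noncomputable def firstFrom (i : Fin n) (s : ℕ) : ℕ := Nat.find (ξ.exists_le_release i s)

theorem le_release_firstFrom (i : Fin n) (s : ℕ) :
    (s : ℕ∞) ≤ ξ.release i (ξ.firstFrom i s) := by
  classical exact Nat.find_spec (ξ.exists_le_release i s)

theorem lt_firstFrom_iff {i : Fin n} {s y : ℕ} :
    y < ξ.firstFrom i s ↔ ξ.release i y < (s : ℕ∞) := by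
  classical
  constructor
  · intro h
    exact not_le.1 (Nat.find_min (ξ.exists_le_release i s) h)
  · intro h
    by_contra! h'
    exact absurd ((ξ.le_release_firstFrom i s).trans (ξ.release_mono i h')) (not_le.2 h)

end ReleasePattern

/-! ### Properties of the schedule -/

section Schedule

variable {𝒯} (ξ : 𝒯.ReleasePattern) (ω : ExecPattern n)

theorem service_mono (i : Fin n) (x : ℕ) : Monotone fun t => 𝒯.service ξ ω t i x :=
  monotone_nat_of_le_succ fun t => by simp only [service]; exact Nat.le_add_right _ _

theorem service_le (t : ℕ) (i : Fin n) (x : ℕ) : 𝒯.service ξ ω t i x ≤ ω (i, x) := by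
  induction t with
  | zero => simp [service]
  | succ t ih =>
    simp only [service]
    split_ifs with h
    · exact h.1.2.2
    · simpa using ih

variable {ξ ω}

theorem Ready.eq {e : Fin n → ℕ → ℕ} {t : ℕ} {i : Fin n} {x y : ℕ}
    (hx : 𝒯.Ready ξ ω e t i x) (hy : 𝒯.Ready ξ ω e t i y) : x = y := by
  by_contra hne
  rcases lt_or_gt_of_ne hne with h | h
  · exact absurd ((ξ.release_add_deadline_le i h).trans hy.1) (not_le.2 hx.2.1)
  · exact absurd ((ξ.release_add_deadline_le i h).trans hx.1) (not_le.2 hy.2.1)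

theorem Ready.exists_runs {e : Fin n → ℕ → ℕ} {t : ℕ} {i : Fin n} {x : ℕ}
    (h : 𝒯.Ready ξ ω e t i x) : ∃ j y, 𝒯.Runs ξ ω e t j y := by
  classical
  have hne : (Finset.univ.filter fun j => ∃ y, 𝒯.Ready ξ ω e t j y).Nonempty :=
    ⟨i, by simpa using ⟨x, h⟩⟩
  obtain ⟨j, hj, hmin⟩ := Finset.exists_min_image _ id hne
  simp only [Finset.mem_filter, Finset.mem_univ, true_and, id] at hj hmin
  obtain ⟨y, hy⟩ := hj
  exact ⟨j, y, hy, fun j' hj' y' hr => absurd (hmin j' ⟨y', hr⟩) (not_le.2 hj'),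
    fun y' hy' hr => absurd (hr.eq hy) hy'.ne⟩

theorem Runs.le_of_ready {e : Fin n → ℕ → ℕ} {t : ℕ} {i j : Fin n} {x y : ℕ}
    (h : 𝒯.Runs ξ ω e t j y) (hr : 𝒯.Ready ξ ω e t i x) : j ≤ i := by
  by_contra! hlt
  exact h.2.1 i hlt x hr

/-- If each slot of `[s, u)` is used by a job in `A`, these jobs receive at least `u - s` units of
service in total. -/
theorem le_sum_service {s u : ℕ} (hsu : s ≤ u) (A : Finset (Fin n × ℕ))
    (h : ∀ v, s ≤ v → v < u → ∃ p ∈ A, 𝒯.Runs ξ ω (𝒯.service ξ ω v) v p.1 p.2) :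
    u - s ≤ ∑ p ∈ A, 𝒯.service ξ ω u p.1 p.2 := by
  classical
  induction u, hsu using Nat.le_induction with
  | base => simp
  | succ u hsu ih =>
    have ih' := ih fun v hv hvu => h v hv (by omega)
    obtain ⟨p, hp, hr⟩ := h u hsu (by omega)
    have hlt : ∑ q ∈ A, 𝒯.service ξ ω u q.1 q.2 < ∑ q ∈ A, 𝒯.service ξ ω (u + 1) q.1 q.2 := by
      refine Finset.sum_lt_sum (fun q _ => service_mono ξ ω q.1 q.2 (Nat.le_succ u)) ⟨p, hp, ?_⟩
      simp [service, hr]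
    omega

/-- A job that misses its relative deadline has not received its full service at its deadline. -/
theorem service_lt_of_deadline_lt_responseTime {i : Fin n} {x r : ℕ} (hr : ξ.release i x = r)
    (h : (𝒯.deadline i : ℕ∞) < 𝒯.responseTime ξ ω i x) :
    𝒯.service ξ ω (r + 𝒯.deadline i) i x < ω (i, x) := by
  by_contra! hle
  refine absurd h (not_lt.2 ?_)
  exact iInf_le_of_le (𝒯.deadline i) (iInf₂_le_of_le (r + 𝒯.deadline i)
    ⟨by rw [hr, Nat.cast_add], hle⟩ le_rfl)

end Schedule

/-! ### The start of the busy interval -/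

section Busy

variable {𝒯} (ξ : 𝒯.ReleasePattern) (ω : ExecPattern n) (k : Fin n) (x : ℕ)

/-- The slots of `[s, r + D_k)` are all used by tasks of priority higher than `k` or by the job
`(k, x)`; the jobs of the tasks from `m` on that run there are released at or after `s`; and
at the end of each of these slots some job released since `s` is pending. -/
structure BusyFrom (r m s : ℕ) : Prop where
  runs : ∀ v, s ≤ v → v < r + 𝒯.deadline k → ∀ j y, 𝒯.Runs ξ ω (𝒯.service ξ ω v) v j y →
    ((j : ℕ) < m ∨ (s : ℕ∞) ≤ ξ.release j y) ∧ (j < k ∨ j = k ∧ y = x)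
  pending : ∀ v, s ≤ v → v < r + 𝒯.deadline k → ∃ j y, (s : ℕ∞) ≤ ξ.release j y ∧
    ξ.release j y ≤ (v : ℕ∞) ∧ ((v + 1 : ℕ) : ℕ∞) ≤ ξ.release j y + (𝒯.deadline j : ℕ∞) ∧
    𝒯.service ξ ω (v + 1) j y < ω (j, y) ∧ (j < k ∨ j = k ∧ y = x)

variable {ξ ω k x}

theorem BusyFrom.refl {r : ℕ} (hr : ξ.release k x = r)
    (hmiss : 𝒯.service ξ ω (r + 𝒯.deadline k) k x < ω (k, x)) : BusyFrom ξ ω k x r k r := by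
  have hserv : ∀ v, v ≤ r + 𝒯.deadline k → 𝒯.service ξ ω v k x < ω (k, x) := fun v hv =>
    (service_mono ξ ω k x hv).trans_lt hmiss
  refine ⟨fun v hrv hv j y hrun => ?_, fun v hrv hv => ⟨k, x, ?_, ?_, ?_, hserv _ hv, ?_⟩⟩
  · have hready : 𝒯.Ready ξ ω (𝒯.service ξ ω v) v k x := by
      refine ⟨?_, ?_, hserv v hv.le⟩
      · rw [hr]; exact_mod_cast hrv
      · rw [hr]; exact_mod_cast hv
    rcases (hrun.le_of_ready hready).lt_or_eq with h | rfl
    · exact ⟨Or.inl h, Or.inl h⟩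
    · obtain rfl := hrun.1.eq hready
      exact ⟨Or.inr hr.ge, Or.inr ⟨rfl, rfl⟩⟩
  · exact hr.ge
  · rw [hr]; exact_mod_cast hrv
  · rw [hr]; exact_mod_cast hv
  · exact Or.inr ⟨rfl, rfl⟩

/-- Extending the interval backwards to the release of a pending job of the next task. -/
theorem BusyFrom.extend {r s s' y : ℕ} {i : Fin n} (hb : BusyFrom ξ ω k x r (i + 1) s)
    (hik : i < k) (hrel : ξ.release i y = s') (hs' : s' < s)
    (hdl : s < s' + 𝒯.deadline i)
    (hserv : 𝒯.service ξ ω s i y < ω (i, y)) : BusyFrom ξ ω k x r i s' := by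
  refine ⟨fun v hs'v hv j z hrun => ?_, fun v hs'v hv => ?_⟩
  · rcases lt_or_ge v s with hvs | hvs
    · have hready : 𝒯.Ready ξ ω (𝒯.service ξ ω v) v i y := by
        refine ⟨?_, ?_, (service_mono ξ ω i y hvs.le).trans_lt hserv⟩
        · rw [hrel]; exact_mod_cast hs'v
        · rw [hrel]; exact_mod_cast hvs.trans hdl
      rcases (hrun.le_of_ready hready).lt_or_eq with h | rfl
      · exact ⟨Or.inl h, Or.inl (h.trans hik)⟩
      · obtain rfl := hrun.1.eq hready
        exact ⟨Or.inr hrel.ge, Or.inl hik⟩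
    · obtain ⟨h1, h2⟩ := hb.runs v hvs hv j z hrun
      refine ⟨?_, h2⟩
      rcases h1 with h1 | h1
      · rcases (Nat.lt_succ_iff.1 h1).lt_or_eq with h | h
        · exact Or.inl h
        · obtain rfl : j = i := Fin.ext h
          refine Or.inr ?_
          rw [← hrel]
          refine ξ.release_mono j ?_
          -- A job of the task preceding `y` has its deadline at or before `s'`, so it cannot run at
          -- `v ≥ s`.
          by_contra! hzy
          have h3 := ξ.release_add_deadline_le j hzy
          have h4 := hrun.1.2.1.trans_le h3
          rw [hrel] at h4
          have : v < s' := by exact_mod_cast h4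
          omega
      · exact Or.inr (le_trans (by exact_mod_cast hs'.le) h1)
  · rcases lt_or_ge v s with hvs | hvs
    · refine ⟨i, y, hrel.ge, ?_, ?_, (service_mono ξ ω i y hvs).trans_lt hserv, Or.inl hik⟩
      · rw [hrel]; exact_mod_cast hs'v
      · rw [hrel]; exact_mod_cast (by omega : v + 1 ≤ s' + 𝒯.deadline i)
    · obtain ⟨j, z, h1, h2⟩ := hb.pending v hvs hv
      exact ⟨j, z, le_trans (by exact_mod_cast hs'.le) h1, h2⟩

/-- The interval need not be extended if the next task has no pending job. -/
theorem BusyFrom.of_not_pending {r s : ℕ} {i : Fin n} (hb : BusyFrom ξ ω k x r (i + 1) s)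
    (hno : ∀ y, ξ.release i y < (s : ℕ∞) → (s : ℕ∞) < ξ.release i y + (𝒯.deadline i : ℕ∞) →
      ω (i, y) ≤ 𝒯.service ξ ω s i y) : BusyFrom ξ ω k x r i s := by
  refine ⟨fun v hsv hv j z hrun => ?_, hb.pending⟩
  obtain ⟨h1, h2⟩ := hb.runs v hsv hv j z hrun
  refine ⟨?_, h2⟩
  rcases h1 with h1 | h1
  · rcases (Nat.lt_succ_iff.1 h1).lt_or_eq with h | h
    · exact Or.inl h
    · obtain rfl : j = i := Fin.ext h
      refine Or.inr ?_
      by_contra! hlt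
      have h3 := hno z hlt (lt_of_le_of_lt (by exact_mod_cast hsv) hrun.1.2.1)
      exact absurd hrun.1.2.2 (not_lt.2 (h3.trans (service_mono ξ ω j z hsv)))
  · exact Or.inr h1

/-- The possible starts of a busy interval ending with the missed deadline. -/
def IsStart (ξ : 𝒯.ReleasePattern) (k : Fin n) (r : ℕ) (i : Fin n) (s : ℕ) : Prop :=
  (i = k ∧ s = r) ∨ (i < k ∧ (∃ y, ξ.release i y = s) ∧ s < r ∧
    r < s + ∑ j ∈ Finset.Ico i k, 𝒯.deadline j)

/-- The descent over priorities. The task `i` that last moved the start is remembered, because the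
total displacement is controlled by the deadlines from `i` to `k`. -/
theorem exists_busyFrom {r : ℕ} (hr : ξ.release k x = r)
    (hmiss : 𝒯.service ξ ω (r + 𝒯.deadline k) k x < ω (k, x)) (m : ℕ) (hm : m ≤ k) :
    ∃ (i : Fin n) (s : ℕ), m ≤ (i : ℕ) ∧ IsStart ξ k r i s ∧ BusyFrom ξ ω k x r m s := by
  induction hm using Nat.decreasingInduction with
  | self => exact ⟨k, r, le_rfl, Or.inl ⟨rfl, rfl⟩, BusyFrom.refl hr hmiss⟩
  | of_succ m hm ih =>
    obtain ⟨i, s, hmi, hstart, hb⟩ := ih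
    have hsr : s ≤ r := by
      rcases hstart with h | h
      · exact h.2.le
      · exact h.2.2.1.le
    have hik : i ≤ k := by
      rcases hstart with h | h
      · exact h.1.le
      · exact h.1.le
    obtain ⟨l, rfl⟩ : ∃ l : Fin n, (l : ℕ) = m := ⟨⟨m, hm.trans k.2⟩, rfl⟩
    by_cases hp : ∃ y, ξ.release l y < (s : ℕ∞) ∧
        (s : ℕ∞) < ξ.release l y + (𝒯.deadline l : ℕ∞) ∧ 𝒯.service ξ ω s l y < ω (l, y)
    · obtain ⟨y, h1, h2, h3⟩ := hp
      obtain ⟨s', hs'⟩ := ENat.ne_top_iff_exists.1 h1.ne_top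
      rw [← hs'] at h1 h2
      have h1' : s' < s := by exact_mod_cast h1
      have h2' : s < s' + 𝒯.deadline l := by exact_mod_cast h2
      refine ⟨l, s', le_rfl, Or.inr ⟨hm, ⟨y, hs'.symm⟩, by omega, ?_⟩,
        hb.extend hm hs'.symm h1' h2' h3⟩
      -- Tasks strictly between `l` and `i` made no move; counting their deadlines only loosens the
      -- bound.
      have hsum : 𝒯.deadline l + ∑ j ∈ Finset.Ico i k, 𝒯.deadline j ≤
          ∑ j ∈ Finset.Ico l k, 𝒯.deadline j := by
        have hli : l < i := hmi
        have hnot : l ∉ Finset.Ico i k := fun h => absurd (Finset.mem_Ico.1 h).1 (not_le.2 hli)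
        rw [← Finset.sum_insert hnot]
        refine Finset.sum_le_sum_of_subset fun j hj => ?_
        rcases Finset.mem_insert.1 hj with rfl | hj
        · exact Finset.mem_Ico.2 ⟨le_rfl, hm⟩
        · exact Finset.mem_Ico.2 ⟨hli.le.trans (Finset.mem_Ico.1 hj).1, (Finset.mem_Ico.1 hj).2⟩
      rcases hstart with h | h
      · omega
      · have := h.2.2.2
        omega
    · push Not at hp
      exact ⟨i, s, by omega, hstart, hb.of_not_pending hp⟩

open Classical in
/-- The jobs released in `[s, u)` that compete with job `(k, x)`, including itself. -/
noncomputable def windowJobs (ξ : 𝒯.ReleasePattern) (k : Fin n) (x s u : ℕ) :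
    Finset (Fin n × ℕ) :=
  (Finset.univ ×ˢ Finset.range u).filter fun p => (s : ℕ∞) ≤ ξ.release p.1 p.2 ∧
    ξ.release p.1 p.2 < (u : ℕ∞) ∧ (p.1 < k ∨ p.1 = k ∧ p.2 = x)

theorem mem_windowJobs {s u : ℕ} {p : Fin n × ℕ} :
    p ∈ windowJobs ξ k x s u ↔ (s : ℕ∞) ≤ ξ.release p.1 p.2 ∧
      ξ.release p.1 p.2 < (u : ℕ∞) ∧ (p.1 < k ∨ p.1 = k ∧ p.2 = x) := by
  simp only [windowJobs, Finset.mem_filter, Finset.mem_product, Finset.mem_univ, true_and,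
    Finset.mem_range, and_iff_right_iff_imp]
  intro h
  exact_mod_cast (ξ.le_release p.1 p.2).trans_lt h.2.1

/-- The execution times for which the work released since `s` exceeds the elapsed time throughout
`(s, e]`. -/
def overload (ξ : 𝒯.ReleasePattern) (k : Fin n) (x s e : ℕ) : Set (ExecPattern n) :=
  {ω | ∀ u, s < u → u ≤ e → u - s < ∑ p ∈ windowJobs ξ k x s u, ω p}

theorem BusyFrom.mem_overload {r s : ℕ} (hb : BusyFrom ξ ω k x r 0 s) :
    ω ∈ overload ξ k x s (r + 𝒯.deadline k) := by
  intro u hsu hu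
  obtain ⟨v, rfl⟩ : ∃ v, u = v + 1 := ⟨u - 1, by omega⟩
  obtain ⟨j, y, h1, h2, -, h4, h5⟩ := hb.pending v (by omega) hu
  -- Full slots give at least `u - s` units of service; the job still pending at `u` makes demand
  -- strictly larger than service.
  refine lt_of_le_of_lt (le_sum_service (ξ := ξ) (ω := ω) hsu.le (windowJobs ξ k x s (v + 1))
    fun w hsw hw => ?_) (Finset.sum_lt_sum (fun p _ => service_le ξ ω _ p.1 p.2)
      ⟨(j, y), mem_windowJobs.2 ⟨h1, h2.trans_lt ?_, h5⟩, h4⟩)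
  · obtain ⟨j', y', -, g2, g3, g4, -⟩ := hb.pending w hsw (by omega)
    have hready : 𝒯.Ready ξ ω (𝒯.service ξ ω w) w j' y' :=
      ⟨g2, lt_of_lt_of_le (by exact_mod_cast Nat.lt_succ_self w) g3,
        (service_mono ξ ω j' y' (Nat.le_succ w)).trans_lt g4⟩
    obtain ⟨l, z, hrun⟩ := hready.exists_runs
    obtain ⟨f1, f2⟩ := hb.runs w hsw (by omega) l z hrun
    refine ⟨(l, z), mem_windowJobs.2 ⟨f1.resolve_left (Nat.not_lt_zero _), ?_, f2⟩, hrun⟩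
    exact hrun.1.1.trans_lt (by exact_mod_cast hw)
  · exact_mod_cast Nat.lt_succ_self v

end Busy

/-! ### Domination by the synchronous pattern -/

section Sync

/-- Renumbering the jobs of each task injectively preserves the law of the execution times. -/
theorem measurePreserving_comp [Nonempty (Fin n)] {φ : Fin n × ℕ → Fin n × ℕ} (hφ : Function.Injective φ)
    (hfst : ∀ p, (φ p).1 = p.1) :
    MeasurePreserving (fun ω : ExecPattern n => ω ∘ φ) 𝒯.execMeasure 𝒯.execMeasure := by
  classical
  have hmeas : Measurable (fun ω : ExecPattern n => ω ∘ φ) :=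
    measurable_pi_lambda _ fun p => measurable_pi_apply (φ p)
  refine ⟨hmeas, ?_⟩
  refine Measure.eq_infinitePi _ fun s t ht => ?_
  rw [Measure.map_apply hmeas (MeasurableSet.pi s.countable_toSet fun p _ => ht p)]
  have hpre : (fun ω : ExecPattern n => ω ∘ φ) ⁻¹' Set.pi (s : Set (Fin n × ℕ)) t =
      Set.pi (s.map ⟨φ, hφ⟩ : Finset (Fin n × ℕ)) fun q => t (Function.invFun φ q) := by
    ext ω
    simp only [Set.mem_preimage, Set.mem_pi, Finset.coe_map, Function.Embedding.coeFn_mk,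
      Set.forall_mem_image, Function.leftInverse_invFun hφ _, Function.comp_apply]
  rw [hpre, execMeasure, Measure.infinitePi_pi _ fun q _ => MeasurableSet.of_discrete,
    Finset.prod_map]
  -- The marginals agree because `φ` keeps the task, and the law of a job depends only on its task.
  refine Finset.prod_congr rfl fun p _ => ?_
  simp only [Function.Embedding.coeFn_mk, Function.leftInverse_invFun hφ _, hfst]

/-- The jobs of the synchronous pattern released in `[0, Δ)`, for positive `Δ`. -/
def syncJobs (k : Fin n) (Δ : ℕ) : Finset (Fin n × ℕ) :=
  insert (k, 0) ((Finset.Iio k ×ˢ Finset.range Δ).filter fun p => p.2 * 𝒯.period p.1 < Δ)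

theorem sum_syncJobs (k : Fin n) (Δ : ℕ) (ω : ExecPattern n) :
    ∑ p ∈ 𝒯.syncJobs k Δ, ω p = ω (k, 0) + ∑ j ∈ Finset.Iio k,
      ∑ y ∈ Finset.range Δ with y * 𝒯.period j < Δ, ω (j, y) := by
  rw [syncJobs, Finset.sum_insert (by simp), Finset.sum_filter, Finset.sum_product]
  simp only [Finset.sum_filter]

/-- The execution times for which the work of the synchronous pattern exceeds the elapsed time
throughout `(0, L]`. -/
def syncOverload (k : Fin n) (L : ℕ) : Set (ExecPattern n) :=
  {ω | ∀ Δ, 0 < Δ → Δ ≤ L → Δ < ∑ p ∈ 𝒯.syncJobs k Δ, ω p}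

theorem measurableSet_syncOverload (k : Fin n) (L : ℕ) :
    MeasurableSet (𝒯.syncOverload k L) := by
  simp only [syncOverload, Set.ofPred_forall]
  refine MeasurableSet.iInter fun Δ => MeasurableSet.iInter fun _ => MeasurableSet.iInter fun _ =>
    measurableSet_lt measurable_const ?_
  exact Finset.measurable_fun_sum _ fun p _ => measurable_pi_apply p

variable {𝒯}

/-- By minimum separation, the `m`-th job of a task from `s` on (counting from zero) is released no
earlier than `s + m T_j`, so every window contains at most the synchronous jobs, up to a renumbering
that preserves the law. -/
theorem execMeasure_overload_le (ξ : 𝒯.ReleasePattern) {k : Fin n} {x s e L : ℕ}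
    (hL : s + L ≤ e) :
    𝒯.execMeasure (overload ξ k x s e) ≤ 𝒯.execMeasure (𝒯.syncOverload k L) := by
  classical
  set φ : Fin n × ℕ → Fin n × ℕ := fun p =>
    (p.1, (if p.1 = k then x else ξ.firstFrom p.1 s) + p.2) with hφ_def
  have hφ : Function.Injective φ := by
    rintro ⟨i, a⟩ ⟨j, b⟩ h
    simp only [hφ_def, Prod.mk.injEq] at h
    obtain ⟨rfl, h⟩ := h
    simpa using h
  have : Nonempty (Fin n) := ⟨k⟩
  have hmp := 𝒯.measurePreserving_comp hφ fun _ => rfl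
  rw [← hmp.measure_preimage (𝒯.measurableSet_syncOverload k L).nullMeasurableSet]
  refine measure_mono fun ω hω Δ hΔ hΔL => ?_
  have h := hω (s + Δ) (by omega) (by omega)
  rw [Nat.add_sub_cancel_left] at h
  refine h.trans_le ?_
  have himg : ∑ p ∈ 𝒯.syncJobs k Δ, (ω ∘ φ) p = ∑ p ∈ (𝒯.syncJobs k Δ).image φ, ω p := by
    rw [Finset.sum_image hφ.injOn]; rfl
  rw [himg]
  refine Finset.sum_le_sum_of_subset ?_
  rintro ⟨j, y⟩ hp
  obtain ⟨h1, h2, h3⟩ := mem_windowJobs.1 hp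
  simp only at h1 h2 h3
  rcases h3 with h3 | ⟨rfl, rfl⟩
  · have hy : ξ.firstFrom j s ≤ y := by
      rw [← not_lt, ξ.lt_firstFrom_iff, not_lt]; exact h1
    obtain ⟨m, rfl⟩ := Nat.exists_eq_add_of_le hy
    refine Finset.mem_image.2 ⟨(j, m), ?_, by simp [hφ_def, h3.ne]⟩
    have hm : m * 𝒯.period j < Δ := by
      have h4 : (s : ℕ∞) + ((m * 𝒯.period j : ℕ) : ℕ∞) < ((s + Δ : ℕ) : ℕ∞) :=
        lt_of_le_of_lt ((add_le_add_left (ξ.le_release_firstFrom j s) _).trans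
          (ξ.release_add_mul_le j _ m)) h2
      have h5 : s + m * 𝒯.period j < s + Δ := by exact_mod_cast h4
      omega
    refine Finset.mem_insert_of_mem (Finset.mem_filter.2 ⟨Finset.mem_product.2
      ⟨Finset.mem_Iio.2 h3, Finset.mem_range.2 (lt_of_le_of_lt ?_ hm)⟩, hm⟩)
    exact Nat.le_mul_of_pos_right m (𝒯.period_pos j)
  · exact Finset.mem_image.2 ⟨(j, 0), Finset.mem_insert_self _ _, by simp [hφ_def]⟩

theorem execMeasure_syncOverload_le_busyPeriod (k : Fin n) {L : ℕ} (hL : 0 < L) :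
    𝒯.execMeasure (𝒯.syncOverload k L) ≤
      𝒯.execMeasure {ω | (L : ℕ∞) ≤ 𝒯.busyPeriod (𝒯.syncPattern k) k ω} := by
  classical
  refine measure_mono fun ω hω => ?_
  change (L : ℕ∞) ≤ 𝒯.busyPeriod (𝒯.syncPattern k) k ω
  refine le_iInf₂ fun Δ hΔ => ?_
  by_contra! hlt
  have hlt' : Δ < L := by exact_mod_cast hlt
  -- Overload says nothing at `Δ = 0`; there the jobs released at time `0` are tested at `1 ≤ L`.
  have h := hω (max Δ 1) (by omega) (by omega)
  have hle : ∑ p ∈ 𝒯.syncJobs k (max Δ 1), ω p ≤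
      𝒯.workload (𝒯.syncPattern k) k ω (max Δ 1) := by
    rw [sum_syncJobs, workload, ← Finset.Iio_insert, Finset.sum_insert (by simp)]
    refine add_le_add ?_ (Finset.sum_le_sum fun j hj => ?_)
    · refine Finset.single_le_sum (f := fun y => ω (k, y)) (fun _ _ => Nat.zero_le _) ?_
      simp [syncPattern]
    · refine Finset.sum_le_sum_of_subset fun y hy => ?_
      rw [Finset.mem_filter] at hy ⊢
      refine ⟨hy.1, ?_⟩
      simp only [syncPattern, if_pos (Finset.mem_Iio.1 hj)]
      exact_mod_cast hy.2
  omega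

theorem execMeasure_syncOverload_le_rho (k : Fin n) {L : ℕ} (hL : 𝒯.deadline k ≤ L) :
    𝒯.execMeasure (𝒯.syncOverload k L) ≤ 𝒯.rho k := by
  refine le_iInf₂ fun t ht => measure_mono fun ω hω => ?_
  have h := hω t ht.1 (ht.2.trans hL)
  rw [sum_syncJobs] at h
  refine h.trans_le (add_le_add le_rfl (Finset.sum_le_sum fun j _ => ?_))
  refine Finset.sum_le_sum_of_subset fun y hy => ?_
  rw [Finset.mem_filter] at hy
  rw [Finset.mem_range, ← not_le, ceilDiv_le_iff_le_mul (𝒯.period_pos j), not_le, mul_comm]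
  exact hy.2

end Sync

/-! ### The union bound -/

section Union

variable {𝒯}

open Classical in
/-- The last but `j - 1` release of task `i` before time `r`; for `i = k` it is `r` itself. -/
noncomputable def startTime (ξ : 𝒯.ReleasePattern) (k : Fin n) (r : ℕ) (i : Fin n) (j : ℕ) : ℕ :=
  if i = k then r else (ξ.release i (ξ.firstFrom i r - j)).toNat

theorem IsStart.exists_startTime {ξ : 𝒯.ReleasePattern} {k i : Fin n} {r s : ℕ}
    (h : IsStart ξ k r i s) : i ≤ k ∧ ∃ j ∈ Finset.Icc 1 (𝒯.numStarts k i),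
      startTime ξ k r i j = s ∧ s + (j - 1) * 𝒯.period i ≤ r := by
  rcases h with ⟨rfl, rfl⟩ | ⟨hik, ⟨y, hy⟩, hsr, hrs⟩
  · exact ⟨le_rfl, 1, by simp [numStarts], by simp [startTime], by simp⟩
  refine ⟨hik.le, ?_⟩
  have hlt : y < ξ.firstFrom i r := by
    rw [ξ.lt_firstFrom_iff, hy]; exact_mod_cast hsr
  -- `m` counts the releases of `i` after job `y` and before `r`; their spacing forces `m T_i < ∑
  -- D_j`, hence `m + 1 ≤ n_i`.
  obtain ⟨m, hm⟩ := Nat.exists_eq_add_of_lt hlt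
  have hbound : s + m * 𝒯.period i < r := by
    have h1 : ξ.release i (y + m) < (r : ℕ∞) := ξ.lt_firstFrom_iff.1 (by omega)
    have h2 := (ξ.release_add_mul_le i y m).trans_lt h1
    rw [hy] at h2
    exact_mod_cast h2
  refine ⟨m + 1, ?_, ?_, by simpa using hbound.le⟩
  · refine Finset.mem_Icc.2 ⟨by omega, ?_⟩
    rw [numStarts, if_neg hik.ne, Nat.succ_le_iff, ← not_le,
      ceilDiv_le_iff_le_mul (𝒯.period_pos i), not_le, mul_comm]
    omega
  · rw [startTime, if_neg hik.ne, show ξ.firstFrom i r - (m + 1) = y by omega, hy]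
    rfl

theorem dfp_le (ξ : 𝒯.ReleasePattern) (k : Fin n) {x r : ℕ} (hr : ξ.release k x = r) :
    𝒯.dfp ξ k x ≤ ∑ i ∈ Finset.Iic k, ∑ j ∈ Finset.Icc 1 (𝒯.numStarts k i),
      min (𝒯.execMeasure {ω | (((j - 1) * 𝒯.period i + 𝒯.deadline k : ℕ) : ℕ∞) ≤
          𝒯.busyPeriod (𝒯.syncPattern k) k ω}) (𝒯.rho k) := by
  -- The first condition does not involve `ω`: if it fails, the event is empty. This also makes
  -- harmless the values of `startTime` that come from truncated subtraction or from `⊤`.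
  set F : Fin n → ℕ → Set (ExecPattern n) := fun i j =>
    {ω | startTime ξ k r i j + (j - 1) * 𝒯.period i ≤ r ∧
      ω ∈ overload ξ k x (startTime ξ k r i j) (r + 𝒯.deadline k)} with hF
  have hcover : {ω | (𝒯.deadline k : ℕ∞) < 𝒯.responseTime ξ ω k x} ⊆
      ⋃ i ∈ Finset.Iic k, ⋃ j ∈ Finset.Icc 1 (𝒯.numStarts k i), F i j := by
    intro ω hω
    obtain ⟨i, s, -, hstart, hb⟩ :=
      exists_busyFrom hr (service_lt_of_deadline_lt_responseTime hr hω) 0 (Nat.zero_le _)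
    obtain ⟨hik, j, hj, rfl, hjr⟩ := hstart.exists_startTime
    simp only [Set.mem_iUnion]
    exact ⟨i, Finset.mem_Iic.2 hik, j, hj, hjr, hb.mem_overload⟩
  refine (measure_mono hcover).trans ((measure_biUnion_finset_le _ _).trans
    (Finset.sum_le_sum fun i _ => (measure_biUnion_finset_le _ _).trans
      (Finset.sum_le_sum fun j _ => ?_)))
  by_cases hs : startTime ξ k r i j + (j - 1) * 𝒯.period i ≤ r
  · have hle : 𝒯.execMeasure (F i j) ≤
        𝒯.execMeasure (𝒯.syncOverload k ((j - 1) * 𝒯.period i + 𝒯.deadline k)) :=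
      (measure_mono fun ω hω => hω.2).trans (execMeasure_overload_le ξ (by omega))
    exact hle.trans (le_min
      (execMeasure_syncOverload_le_busyPeriod k (Nat.add_pos_right _ (𝒯.deadline_pos k)))
      (execMeasure_syncOverload_le_rho k (Nat.le_add_left _ _)))
  · have hempty : F i j = ∅ := Set.eq_empty_of_forall_notMem fun ω hω => hs hω.1
    simp [hempty]

end Union

end TaskSet

theorem mainTheorem2 {n : ℕ} (𝒯 : TaskSet n) (k : Fin n) :
    𝒯.wcdfp k ≤
      ∑ i ∈ Finset.Iic k, ∑ j ∈ Finset.Icc 1 (𝒯.numStarts k i),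
        min (𝒯.execMeasure {ω | (((j - 1) * 𝒯.period i + 𝒯.deadline k : ℕ) : ℕ∞) ≤
            𝒯.busyPeriod (𝒯.syncPattern k) k ω})
          (𝒯.rho k) := by
  refine iSup_le fun ξ => iSup₂_le fun x hx => ?_
  obtain ⟨r, hr⟩ := ENat.ne_top_iff_exists.1 hx
  exact TaskSet.dfp_le ξ k hr.symm
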